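/- Let $\alpha,\lambda_\ell,\rho_p,\rho_s>0$. Let the positions of the primary receivers form a homogeneous Poisson point process $\Phi_\ell$ of density $\lambda_\ell$ in $\mathbb{R}^2$, and let $d_\ell$ be the distance of receiver $\ell$ from the origin (where the secondary base station is located). Let the fading coefficients $\hat g_\ell\sim\mathcal{CN}(0,1)$ be independent of each other and of the positions (Rayleigh fading), and let $|g_\ell|^2=|\hat g_\ell|^2/(1+d_\ell^{\alpha})$ be the channel gain to receiver $\ell$. Put $\delta=2/\alpha$ and $a_\ell=\delta\pi\lambda_\ell\Gamma(\delta)/\rho_p^{\delta}$, and consider the effective transmit signal-to-noise ratio $$\gamma_t=\min\Big\{\frac{\rho_p}{\max_{\ell\in\Phi_\ell}|g_\ell|^2},\ \rho_s\Big\}.$$ Then the maximum is almost surely attained and positive, and for every $\mu>0$ $$\Pr\Big\{\max_{\ell\in\Phi_\ell}|g_\ell|^2\le\mu\Big\}=\exp\Big(-e^{-\mu}\,\frac{\delta\pi\lambda_\ell\Gamma(\delta)}{\mu^{\delta}}\Big).$$ Moreover the distribution of $\gamma_t$ is the sum of a point mass at $\rho_s$ of weight $\exp\big(-a_\ell\rho_s^{\delta}e^{-\rho_p/\rho_s}\big)$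 and the absolutely continuous measure on $(0,\rho_s)$ with density $$\Big(\frac{\rho_p}{x}+\delta\Big)a_\ell x^{\delta-1}\exp\Big(-a_\ell x^{\delta}e^{-\rho_p/x}-\frac{\rho_p}{x}\Big),\qquad 0<x<\rho_s .$$ -/

import Mathlib

open MeasureTheory ProbabilityTheory
open scoped ENNReal NNReal

namespace SpectrumSharing

/-- The Euclidean plane in which the primary receivers are deployed. -/
abbrev Plane : Type := EuclideanSpace ℝ (Fin 2)

/-- The circularly symmetric complex Gaussian distribution `CN(0,1)`: real and imaginary part are
independent centred real Gaussians of variance `1/2`, so that the total variance is `1`. -/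
noncomputable def complexGaussian : Measure ℂ :=
  ((gaussianReal 0 (1 / 2)).prod (gaussianReal 0 (1 / 2))).map
    (fun p : ℝ × ℝ => (⟨p.1, p.2⟩ : ℂ))

/-- The random subset `Φ` of the plane is a homogeneous Poisson point process of density `lam`:
the number of its points in a Borel set `B` of finite area is Poisson distributed with mean
`lam * area B`, and the numbers of points in finitely many pairwise disjoint such sets are
independent. -/
structure IsHomogeneousPPP {Ω : Type*} [MeasurableSpace Ω] (Φ : Ω → Set Plane) (lam : ℝ)
    (P : Measure Ω) : Prop where
  hasLaw_count : ∀ B : Set Plane, MeasurableSet B → volume B ≠ ∞ →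
    HasLaw (fun ω => (Φ ω ∩ B).encard)
      ((poissonMeasure (ENNReal.ofReal lam * volume B).toNNReal).map (Nat.cast : ℕ → ℕ∞)) P
  iIndepFun_count : ∀ (n : ℕ) (B : Fin n → Set Plane), (∀ i, MeasurableSet (B i)) →
    (∀ i, volume (B i) ≠ ∞) → Pairwise (fun i j => Disjoint (B i) (B j)) →
    iIndepFun (fun i ω => (Φ ω ∩ B i).encard) P

/-- The bounded path loss `L(d) = 1 / (1 + d ^ α)`. -/
noncomputable def pathLoss (α d : ℝ) : ℝ := 1 / (1 + d ^ α)

/-- The overall channel gain `|g|² = |ĝ|² L(d)` from the secondary base station at the origin to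
a primary receiver at `x` with small-scale fading coefficient `ĝ = h`. -/
noncomputable def channelGain (α : ℝ) (x : Plane) (h : ℂ) : ℝ := ‖h‖ ^ 2 * pathLoss α ‖x‖

/-- The maximum of the channel gains over all primary receivers, as an extended nonnegative
number (a supremum, so that it makes sense for every realization). -/
noncomputable def maxGain (α : ℝ) (x : ℕ → Plane) (h : ℕ → ℂ) : ℝ≥0∞ :=
  ⨆ l, ENNReal.ofReal (channelGain α (x l) (h l))

/-- The effective transmit SNR `min {ρp / max_l |g_l|², ρs}`. -/
noncomputable def effectiveSNR (α ρp ρs : ℝ) (x : ℕ → Plane) (h : ℕ → ℂ) : ℝ :=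
  (min (ENNReal.ofReal ρp / maxGain α x h) (ENNReal.ofReal ρs)).toReal

/-- The constant `a = δ π lam Γ(δ) / ρp ^ δ` with `δ = 2 / α`. -/
noncomputable def aCoeff (α lam ρp : ℝ) : ℝ :=
  (2 / α) * Real.pi * lam * Real.Gamma (2 / α) / ρp ^ (2 / α)

/-- The weight `exp (-a ρs ^ δ exp (-ρp / ρs))` of the point mass at `ρs`. -/
noncomputable def atomWeight (α lam ρp ρs : ℝ) : ℝ :=
  Real.exp (-(aCoeff α lam ρp * ρs ^ (2 / α) * Real.exp (-(ρp / ρs))))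

/-- The density
`(ρp / x + δ) a x ^ (δ - 1) exp (-a x ^ δ exp (-ρp / x) - ρp / x)` on `(0, ρs)`. -/
noncomputable def snrDensity (α lam ρp x : ℝ) : ℝ :=
  (ρp / x + 2 / α) * aCoeff α lam ρp * x ^ (2 / α - 1) *
    Real.exp (-(aCoeff α lam ρp * x ^ (2 / α) * Real.exp (-(ρp / x))) - ρp / x)

end SpectrumSharing

/-! ### Area integral of the exceedance probability -/

namespace SpectrumSharing

/-! Under Rayleigh fading the squared modulus of a coefficient is exponential
(`complexGaussian_lt_norm_sq`), so a receiver at `z` has gain above `m` with probability `u z = exp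
(-m (1 + ‖z‖ ^ α))`. Given the positions, no gain exceeds `m` with probability the product of `1 -
u` over the points. The mean of that product is the probability generating functional `exp (-lam ∫
u)` of the Poisson process (`lintegral_infProd_one_sub`), and `∫ u` is a Gamma integral in polar
coordinates. This gives the distribution function of the maximum.

Attainment: by Campbell's formula the exceedance probabilities of a level `m > 0` have a finite sum,
so by Borel–Cantelli only finitely many gains lie above it, while one fixed gain is almost surely
positive.

For `0 < t ≤ ρs`, the SNR is at least `t` exactly when the maximum is at most `ρp / t`. Its survival
function is therefore known up to `ρs`, beyond which it vanishes: the jump there is the atom, and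
minus its derivative on `(0, ρs)` is the density. -/

lemma integral_exp_neg_mul_one_add_norm_rpow {α m : ℝ} (hα : 0 < α) (hm : 0 < m) :
    ∫ x : Plane, Real.exp (-(m * (1 + ‖x‖ ^ α))) =
      Real.exp (-m) * ((2 / α) * Real.pi * Real.Gamma (2 / α)) / m ^ (2 / α) := by
  have hvol : (volume : Measure Plane).real (Metric.ball 0 1) = Real.pi := by
    simp [Measure.real, EuclideanSpace.volume_ball_fin_two, Real.pi_nonneg]
  have hrad := integral_fun_norm_addHaar (volume : Measure Plane)
    (fun r => Real.exp (-(m * (1 + r ^ α))))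
  rw [hrad, hvol, finrank_euclideanSpace_fin]
  have h1 : ∀ y : ℝ, y ^ (2 - 1) • Real.exp (-(m * (1 + y ^ α))) =
      Real.exp (-m) * (y ^ (1 : ℝ) * Real.exp (-m * y ^ α)) := fun y => by
    rw [show -(m * (1 + y ^ α)) = -m + -m * y ^ α by ring, Real.exp_add]
    simp
    ring
  simp_rw [h1]
  rw [integral_const_mul, integral_rpow_mul_exp_neg_mul_rpow hα (by norm_num) hm,
    show -((1 : ℝ) + 1) / α = -(2 / α) by ring, Real.rpow_neg hm.le,
    show ((1 : ℝ) + 1) / α = 2 / α by ring]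
  simp only [nsmul_eq_mul, smul_eq_mul]
  push_cast
  ring

lemma lintegral_exp_neg_mul_one_add_norm_rpow {α m : ℝ} (hα : 0 < α) (hm : 0 < m) :
    ∫⁻ x : Plane, ENNReal.ofReal (Real.exp (-(m * (1 + ‖x‖ ^ α)))) =
      ENNReal.ofReal
        (Real.exp (-m) * ((2 / α) * Real.pi * Real.Gamma (2 / α)) / m ^ (2 / α)) := by
  rw [← integral_exp_neg_mul_one_add_norm_rpow hα hm, ofReal_integral_eq_lintegral_ofReal]
  -- The Bochner integral of a non-integrable function is `0`, so the positive value just computed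
  -- proves integrability.
  · refine Integrable.of_integral_ne_zero ?_
    rw [integral_exp_neg_mul_one_add_norm_rpow hα hm]
    have := Real.Gamma_pos_of_pos (show 0 < 2 / α by positivity)
    positivity
  · exact Filter.Eventually.of_forall fun x => (Real.exp_pos _).le

/-! ### Squared modulus of a complex Gaussian -/

lemma lintegral_Ioi_mul_exp_neg_sq {t : ℝ} (ht : 0 ≤ t) :
    ∫⁻ r in Set.Ioi √t, ENNReal.ofReal (2 * r * Real.exp (-r ^ 2)) =
      ENNReal.ofReal (Real.exp (-t)) := by
  have hd : ∀ r ∈ Set.Ici √t, HasDerivAt (fun r : ℝ => -Real.exp (-r ^ 2))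
      (2 * r * Real.exp (-r ^ 2)) r := fun r _ => by
    refine ((hasDerivAt_pow 2 r).neg.exp.neg).congr_deriv ?_
    simp
    ring
  have hpos : ∀ r ∈ Set.Ioi √t, 0 ≤ 2 * r * Real.exp (-r ^ 2) := fun r hr => by
    have : 0 ≤ r := (Real.sqrt_nonneg t).trans (le_of_lt hr)
    positivity
  have hlim : Filter.Tendsto (fun r : ℝ => -Real.exp (-r ^ 2)) Filter.atTop (nhds 0) := by
    rw [← neg_zero]
    exact (Real.tendsto_exp_neg_atTop_nhds_zero.comp
      (Filter.tendsto_pow_atTop two_ne_zero)).neg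
  have hint := integrableOn_Ioi_deriv_of_nonneg' hd hpos hlim
  rw [← ofReal_integral_eq_lintegral_ofReal hint
    ((ae_restrict_iff' measurableSet_Ioi).2 (Filter.Eventually.of_forall hpos)),
    integral_Ioi_of_hasDerivAt_of_tendsto' hd hint hlim]
  simp [Real.sq_sqrt ht]

lemma gaussianPDF_half_mul (a b : ℝ) :
    gaussianPDF 0 (1 / 2) a * gaussianPDF 0 (1 / 2) b =
      ENNReal.ofReal (Real.pi⁻¹ * Real.exp (-(a ^ 2 + b ^ 2))) := by
  rw [gaussianPDF, gaussianPDF, ← ENNReal.ofReal_mul (gaussianPDFReal_nonneg _ _ _)]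
  congr 1
  simp only [gaussianPDFReal, NNReal.coe_div, NNReal.coe_one, NNReal.coe_ofNat]
  rw [show 2 * Real.pi * (1 / 2) = Real.pi by ring]
  rw [mul_mul_mul_comm, ← Real.exp_add, ← mul_inv, Real.mul_self_sqrt Real.pi_nonneg]
  congr 2
  ring

/-- The squared modulus of a `CN(0,1)` variable is exponentially distributed. -/
lemma complexGaussian_lt_norm_sq {t : ℝ} (ht : 0 ≤ t) :
    complexGaussian {z | t < ‖z‖ ^ 2} = ENNReal.ofReal (Real.exp (-t)) := by
  have hmk : Measurable (fun p : ℝ × ℝ => (⟨p.1, p.2⟩ : ℂ)) :=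
    Complex.measurableEquivRealProd.symm.measurable
  have hS : MeasurableSet {z : ℂ | t < ‖z‖ ^ 2} :=
    measurableSet_lt measurable_const (by fun_prop)
  have hS' : MeasurableSet {p : ℝ × ℝ | t < p.1 ^ 2 + p.2 ^ 2} :=
    measurableSet_lt measurable_const (by fun_prop)
  have hpre : (fun p : ℝ × ℝ => (⟨p.1, p.2⟩ : ℂ)) ⁻¹' {z : ℂ | t < ‖z‖ ^ 2} =
      {p : ℝ × ℝ | t < p.1 ^ 2 + p.2 ^ 2} := by
    ext p
    rw [Set.mem_preimage, Set.mem_ofPred_eq, Set.mem_ofPred_eq, Complex.sq_norm, Complex.normSq_mk,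
      sq, sq]
  rw [complexGaussian, Measure.map_apply hmk hS, hpre,
    gaussianReal_of_var_ne_zero 0 (by norm_num),
    prod_withDensity (measurable_gaussianPDF _ _) (measurable_gaussianPDF _ _),
    withDensity_apply _ hS', ← lintegral_indicator hS']
  simp_rw [gaussianPDF_half_mul]
  rw [← Measure.volume_eq_prod, ← lintegral_comp_polarCoord_symm]
  -- The integrand does not depend on the angle. The trailing factor `1` displays it as a product of
  -- a radial and an angular function, ready for Tonelli.
  have hpt : ∀ p ∈ polarCoord.target, ENNReal.ofReal p.1 •
      ({p : ℝ × ℝ | t < p.1 ^ 2 + p.2 ^ 2}.indicator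
        (fun a => ENNReal.ofReal (Real.pi⁻¹ * Real.exp (-(a.1 ^ 2 + a.2 ^ 2))))
        (polarCoord.symm p)) =
      (Set.Ioi √t).indicator (fun r => ENNReal.ofReal ((2 * Real.pi)⁻¹) *
        ENNReal.ofReal (2 * r * Real.exp (-r ^ 2))) p.1 * 1 := by
    rintro ⟨r, θ⟩ hp
    simp only [polarCoord_target, Set.mem_prod, Set.mem_Ioi] at hp
    have hr := hp.1
    have hsq : (r * Real.cos θ) ^ 2 + (r * Real.sin θ) ^ 2 = r ^ 2 := by
      linear_combination r ^ 2 * Real.cos_sq_add_sin_sq θ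
    have hiff : t < r ^ 2 ↔ √t < r := (Real.sqrt_lt' hr).symm
    simp only [polarCoord_symm_apply, Set.indicator_apply, Set.mem_ofPred_eq, hsq, hiff,
      Set.mem_Ioi, mul_one]
    split_ifs
    · rw [smul_eq_mul, ← ENNReal.ofReal_mul hr.le, ← ENNReal.ofReal_mul (by positivity)]
      congr 1
      have := Real.pi_pos
      field_simp
    · simp
  rw [setLIntegral_congr_fun polarCoord.open_target.measurableSet hpt, polarCoord_target,
    Measure.volume_eq_prod, ← Measure.prod_restrict,
    lintegral_prod_mul
      (f := (Set.Ioi √t).indicator (fun r => ENNReal.ofReal ((2 * Real.pi)⁻¹) *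
        ENNReal.ofReal (2 * r * Real.exp (-r ^ 2)))) (g := fun _ => 1)
      (AEMeasurable.indicator (by fun_prop) measurableSet_Ioi) (by fun_prop),
    lintegral_indicator measurableSet_Ioi, Measure.restrict_restrict measurableSet_Ioi,
    Set.inter_eq_left.2 (Set.Ioi_subset_Ioi (Real.sqrt_nonneg t)),
    lintegral_const_mul _ (by fun_prop), lintegral_Ioi_mul_exp_neg_sq ht]
  simp only [lintegral_const, one_mul, Measure.restrict_apply_univ, Real.volume_Ioo]
  rw [← ENNReal.ofReal_mul (by positivity), ← ENNReal.ofReal_mul (by positivity)]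
  congr 1
  have := Real.pi_pos
  field_simp
  ring

/-! ### Poisson moments and products of independent variables -/

/-- The probability generating function of the Poisson distribution. -/
lemma lintegral_pow_poissonMeasure (r : ℝ≥0) {s : ℝ} (hs : 0 ≤ s) :
    ∫⁻ n, ENNReal.ofReal s ^ n ∂poissonMeasure r =
      ENNReal.ofReal (Real.exp (-(r * (1 - s)))) := by
  rw [poissonMeasure, lintegral_sum_measure]
  have hsum : HasSum (fun n : ℕ => Real.exp (-r) * r ^ n / n.factorial * s ^ n)
      (Real.exp (-(r * (1 - s)))) := by
    have h := (NormedSpace.expSeries_div_hasSum_exp ((r : ℝ) * s)).mul_left (Real.exp (-r))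
    rw [← Real.exp_eq_exp_ℝ, ← Real.exp_add,
      show -(r : ℝ) + r * s = -(r * (1 - s)) by ring] at h
    refine h.congr_fun fun n => ?_
    rw [mul_pow]
    ring
  rw [← hsum.tsum_eq, ENNReal.ofReal_tsum_of_nonneg (fun n => by positivity) hsum.summable]
  refine tsum_congr fun n => ?_
  rw [lintegral_smul_measure, lintegral_dirac, smul_eq_mul, ← ENNReal.ofReal_pow hs,
    ← ENNReal.ofReal_mul (by positivity)]

/-- The mean of the Poisson distribution. -/
lemma lintegral_natCast_poissonMeasure (r : ℝ≥0) :
    ∫⁻ n, (n : ℝ≥0∞) ∂poissonMeasure r = r := by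
  rw [poissonMeasure, lintegral_sum_measure, tsum_eq_zero_add' ENNReal.summable]
  -- The term at `0` vanishes, and `(n + 1) / (n + 1)! = 1 / n!` turns the shifted series into `r`
  -- times the total mass.
  have hstep : ∀ n : ℕ, ∫⁻ k, (k : ℝ≥0∞) ∂(ENNReal.ofReal
      (Real.exp (-r) * r ^ (n + 1) / (n + 1).factorial) • Measure.dirac (n + 1)) =
      r * ENNReal.ofReal (Real.exp (-r) * r ^ n / n.factorial) := fun n => by
    rw [lintegral_smul_measure, lintegral_dirac, smul_eq_mul, ← ENNReal.ofReal_coe_nnreal,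
      ← ENNReal.ofReal_mul r.coe_nonneg, ← ENNReal.ofReal_natCast,
      ← ENNReal.ofReal_mul (by positivity), Nat.factorial_succ]
    congr 1
    push_cast
    field_simp
    ring
  simp_rw [hstep]
  rw [ENNReal.tsum_mul_left, ← ENNReal.ofReal_tsum_of_nonneg (fun n => by positivity)
    (hasSum_one_poissonMeasure r).summable, (hasSum_one_poissonMeasure r).tsum_eq]
  simp

/-- Point counts come only with almost everywhere measurability, so each factor is replaced by a
measurable version. -/
lemma lintegral_prod_of_iIndepFun {Ω ι : Type*} [Fintype ι] [MeasurableSpace Ω] {P : Measure Ω}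
    {X : ι → Ω → ℝ≥0∞} (hX : iIndepFun X P) (hm : ∀ i, AEMeasurable (X i) P) :
    ∫⁻ ω, ∏ i, X i ω ∂P = ∏ i, ∫⁻ ω, X i ω ∂P := by
  have hall : ∀ᵐ ω ∂P, ∀ i, X i ω = (hm i).mk (X i) ω := ae_all_iff.2 fun i => (hm i).ae_eq_mk
  rw [lintegral_congr_ae (g := fun ω => ∏ i, (hm i).mk (X i) ω)
    (hall.mono fun ω h => Finset.prod_congr rfl fun i _ => h i),
    lintegral_prod_eq_prod_lintegral_of_indepFun Finset.univ _
      ((iIndepFun_congr fun i => (hm i).ae_eq_mk).1 hX) fun i => (hm i).measurable_mk]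
  exact Finset.prod_congr rfl fun i _ => (lintegral_congr_ae (hm i).ae_eq_mk).symm

/-! ### Probability generating functional and Campbell's formula -/

/-- The infinite product of the values of a `[0, 1]`-valued function along a sequence. -/
noncomputable def infProd {E : Type*} (f : E → ℝ≥0∞) (y : ℕ → E) : ℝ≥0∞ :=
  ⨅ K, ∏ l ∈ Finset.range K, f (y l)

/-- Each index landing in `B i` contributes a factor `s i`. Since `s i ≤ 1` the partial products
decrease, and they are constant once all of the finitely many such indices have been passed. -/
lemma infProd_eq_prod_pow {E : Type*} {n : ℕ} (y : ℕ → E) (B : Fin n → Set E)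
    (s : Fin n → ℝ≥0∞) (hs : ∀ i, s i ≤ 1) (hfin : ∀ i, {l | y l ∈ B i}.Finite) :
    infProd (fun z => ∏ i, (B i).mulIndicator (fun _ => s i) z) y =
      ∏ i, s i ^ {l | y l ∈ B i}.ncard := by
  classical
  have hprod : ∀ K, ∏ l ∈ Finset.range K, ∏ i, (B i).mulIndicator (fun _ => s i) (y l) =
      ∏ i, s i ^ ((Finset.range K).filter (fun l => y l ∈ B i)).card := fun K => by
    rw [Finset.prod_comm]
    refine Finset.prod_congr rfl fun i _ => ?_
    simp only [Set.mulIndicator_apply]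
    rw [Finset.prod_ite, Finset.prod_const, Finset.prod_const_one, mul_one]
  have hle : ∀ K i, ((Finset.range K).filter (fun l => y l ∈ B i)).card ≤
      {l | y l ∈ B i}.ncard := fun K i => by
    rw [← Set.ncard_coe_finset]
    exact Set.ncard_le_ncard (fun l hl => by simpa using (Finset.mem_filter.1 hl).2) (hfin i)
  apply le_antisymm
  · obtain ⟨K, hK⟩ := (Set.finite_iUnion hfin).bddAbove
    refine iInf_le_of_le (K + 1) ?_
    rw [hprod]
    refine Finset.prod_le_prod' fun i _ => ?_
    rw [← Set.ncard_coe_finset]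
    refine le_of_eq ?_
    congr 2
    ext l
    simp only [Finset.coe_filter, Finset.mem_range, Set.mem_ofPred_eq, and_iff_right_iff_imp]
    intro hl
    exact Nat.lt_succ_of_le (hK (Set.mem_iUnion.2 ⟨i, hl⟩))
  · refine le_iInf fun K => ?_
    rw [hprod]
    exact Finset.prod_le_prod' fun i _ => pow_le_pow_right_of_le_one' (hs i) (hle K i)

section PoissonProcess

variable {Ω : Type*} [MeasurableSpace Ω] {P : Measure Ω} {lam : ℝ} {Φ : Ω → Set Plane}
  {x : ℕ → Ω → Plane}

lemma encard_inter_of_bijOn {Ψ : Set Plane} {y : ℕ → Plane} (hy : Set.BijOn y Set.univ Ψ)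
    (B : Set Plane) : (Ψ ∩ B).encard = {l | y l ∈ B}.encard := by
  have himg : Ψ ∩ B = y '' {l | y l ∈ B} := by
    rw [← hy.image_eq]
    ext z
    constructor
    · rintro ⟨⟨l, -, rfl⟩, hl⟩
      exact ⟨l, hl, rfl⟩
    · rintro ⟨l, hl, rfl⟩
      exact ⟨⟨l, trivial, rfl⟩, hl⟩
  rw [himg, (hy.injOn.mono (Set.subset_univ _)).encard_image]

lemma IsHomogeneousPPP.lintegral_encard (hΦ : IsHomogeneousPPP Φ lam P) {B : Set Plane}
    (hB : MeasurableSet B) (hfin : volume B ≠ ∞) (g : ℕ∞ → ℝ≥0∞) :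
    ∫⁻ ω, g (Φ ω ∩ B).encard ∂P =
      ∫⁻ n, g n ∂poissonMeasure (ENNReal.ofReal lam * volume B).toNNReal := by
  have hlaw := hΦ.hasLaw_count B hB hfin
  have hg : Measurable g := measurable_of_countable g
  rw [← lintegral_map' (f := g) hg.aemeasurable hlaw.aemeasurable, hlaw.map_eq,
    lintegral_map hg (measurable_of_countable _)]

lemma IsHomogeneousPPP.ae_finite (hΦ : IsHomogeneousPPP Φ lam P) {B : Set Plane}
    (hB : MeasurableSet B) (hfin : volume B ≠ ∞) : ∀ᵐ ω ∂P, (Φ ω ∩ B).Finite := by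
  have hlaw := hΦ.hasLaw_count B hB hfin
  have h : ∀ᵐ n ∂(P.map fun ω => (Φ ω ∩ B).encard), n ≠ ⊤ := by
    rw [hlaw.map_eq, ae_map_iff (measurable_of_countable _).aemeasurable
      (MeasurableSet.of_discrete)]
    exact Filter.Eventually.of_forall fun n => ENat.natCast_ne_top n
  filter_upwards [ae_of_ae_map hlaw.aemeasurable h] with ω hω
  exact Set.encard_ne_top_iff.1 hω

lemma tsum_measure_preimage (hΦ : IsHomogeneousPPP Φ lam P) (hx : ∀ l, Measurable (x l))
    (hxΦ : ∀ᵐ ω ∂P, Set.BijOn (fun l => x l ω) Set.univ (Φ ω)) {B : Set Plane}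
    (hB : MeasurableSet B) (hfin : volume B ≠ ∞) :
    ∑' l, P (x l ⁻¹' B) = ENNReal.ofReal lam * volume B := by
  have h1 : ∀ l, P (x l ⁻¹' B) = ∫⁻ ω, B.indicator 1 (x l ω) ∂P := fun l => by
    rw [← lintegral_indicator_one (hx l hB)]
    rfl
  simp_rw [h1]
  have h0 : ∀ l, AEMeasurable (fun ω => B.indicator (1 : Plane → ℝ≥0∞) (x l ω)) P := fun l =>
    ((measurable_one.indicator hB).comp (hx l)).aemeasurable
  rw [← lintegral_tsum h0]
  have h2 : ∀ᵐ ω ∂P, ∑' l, B.indicator (1 : Plane → ℝ≥0∞) (x l ω) =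
      ((Φ ω ∩ B).encard : ℝ≥0∞) := by
    filter_upwards [hxΦ] with ω hω
    rw [encard_inter_of_bijOn hω B, ← ENNReal.tsum_set_one]
    exact (tsum_subtype {l | x l ω ∈ B} (fun _ => (1 : ℝ≥0∞))).symm
  rw [lintegral_congr_ae h2, hΦ.lintegral_encard hB hfin (fun n => (n : ℝ≥0∞))]
  simp only [ENat.toENNReal_coe]
  rw [lintegral_natCast_poissonMeasure,
    ENNReal.coe_toNNReal (ENNReal.mul_ne_top ENNReal.ofReal_ne_top hfin)]

/-- Campbell's formula. -/
lemma tsum_lintegral_comp (hΦ : IsHomogeneousPPP Φ lam P) (hx : ∀ l, Measurable (x l))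
    (hxΦ : ∀ᵐ ω ∂P, Set.BijOn (fun l => x l ω) Set.univ (Φ ω)) {u : Plane → ℝ≥0∞}
    (hu : Measurable u) :
    ∑' l, ∫⁻ ω, u (x l ω) ∂P = ENNReal.ofReal lam * ∫⁻ z, u z := by
  have hM : Measure.sum (fun l => P.map (x l)) = ENNReal.ofReal lam • (volume : Measure Plane) := by
    -- The Poisson mean is available only for sets of finite area, so `B` is exhausted by its
    -- intersections with balls.
    ext B hB
    have hmono : Monotone fun n : ℕ => B ∩ Metric.ball (0 : Plane) n := fun m n hmn =>
      Set.inter_subset_inter_right _ (Metric.ball_subset_ball (by exact_mod_cast hmn))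
    have hU : B = ⋃ n : ℕ, B ∩ Metric.ball (0 : Plane) n := by
      rw [← Set.inter_iUnion, Metric.iUnion_ball_nat, Set.inter_univ]
    rw [hU, hmono.measure_iUnion, hmono.measure_iUnion]
    refine iSup_congr fun n => ?_
    have hBn := hB.inter (measurableSet_ball (x := (0 : Plane)) (ε := n))
    rw [Measure.sum_apply _ hBn, Measure.smul_apply, smul_eq_mul,
      ← tsum_measure_preimage hΦ hx hxΦ hBn
        (measure_ne_top_of_subset Set.inter_subset_right measure_ball_lt_top.ne)]
    exact tsum_congr fun l => Measure.map_apply (hx l) hBn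
  rw [← smul_eq_mul, ← lintegral_smul_measure, ← hM, lintegral_sum_measure]
  exact tsum_congr fun l => (lintegral_map hu (hx l)).symm

end PoissonProcess

/-- The two infima commute, and a finite product is continuous along decreasing factors because the
bound by `1` keeps them finite. -/
lemma infProd_iInf {E : Type*} {f : ℕ → E → ℝ≥0∞} (hf : Antitone f) (h1 : ∀ n z, f n z ≤ 1)
    (y : ℕ → E) : infProd (fun z => ⨅ n, f n z) y = ⨅ n, infProd (f n) y := by
  unfold infProd
  rw [iInf_comm]
  refine iInf_congr fun K => ?_
  have h2 : ∀ z, Filter.Tendsto (fun n => f n z) Filter.atTop (nhds (⨅ n, f n z)) := fun z =>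
    tendsto_atTop_iInf fun m n hmn => hf hmn z
  have h3 := ENNReal.tendsto_finsetProd_of_ne_top (Finset.range K) (fun l _ => h2 (y l))
    (fun l _ => ne_top_of_le_ne_top ENNReal.one_ne_top (iInf_le_of_le 0 (h1 0 (y l))))
  exact tendsto_nhds_unique h3
    (tendsto_atTop_iInf fun m n hmn => Finset.prod_le_prod' fun l _ => hf hmn (y l))

lemma measurable_infProd {Ω E : Type*} [MeasurableSpace Ω] [MeasurableSpace E] {f : E → ℝ≥0∞}
    (hf : Measurable f) {x : ℕ → Ω → E} (hx : ∀ l, Measurable (x l)) :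
    Measurable fun ω => infProd f fun l => x l ω :=
  Measurable.iInf fun _ => Finset.measurable_fun_prod _ fun l _ => hf.comp (hx l)

section PoissonProcess

variable {Ω : Type*} [MeasurableSpace Ω] {P : Measure Ω} {lam : ℝ} {Φ : Ω → Set Plane}
  {x : ℕ → Ω → Plane}

/-- The product along the points is `∏ s i ^ N i` with `N i` the count in `B i`; independence of the
counts and the Poisson generating function finish. -/
lemma lintegral_infProd_step (hΦ : IsHomogeneousPPP Φ lam P)
    (hxΦ : ∀ᵐ ω ∂P, Set.BijOn (fun l => x l ω) Set.univ (Φ ω))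
    {n : ℕ} {B : Fin n → Set Plane} (hB : ∀ i, MeasurableSet (B i)) (hfin : ∀ i, volume (B i) ≠ ∞)
    (hdisj : Pairwise fun i j => Disjoint (B i) (B j)) {s : Fin n → ℝ} (hs0 : ∀ i, 0 ≤ s i)
    (hs1 : ∀ i, s i ≤ 1) :
    ∫⁻ ω, infProd (fun z => ∏ i, (B i).mulIndicator (fun _ => ENNReal.ofReal (s i)) z)
        (fun l => x l ω) ∂P =
      ∏ i, ENNReal.ofReal
        (Real.exp (-((ENNReal.ofReal lam * volume (B i)).toReal * (1 - s i)))) := by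
  have hae : ∀ᵐ ω ∂P, infProd (fun z => ∏ i, (B i).mulIndicator
      (fun _ => ENNReal.ofReal (s i)) z) (fun l => x l ω) =
      ∏ i, ENNReal.ofReal (s i) ^ (Φ ω ∩ B i).encard.toNat := by
    filter_upwards [hxΦ, ae_all_iff.2 fun i => hΦ.ae_finite (hB i) (hfin i)] with ω hω hf
    have hcard := fun i => encard_inter_of_bijOn hω (B i)
    simp_rw [hcard]
    refine infProd_eq_prod_pow _ B _ (fun i => ENNReal.ofReal_le_one.2 (hs1 i)) fun i => ?_
    rw [← Set.encard_ne_top_iff, ← hcard, Set.encard_ne_top_iff]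
    exact hf i
  let g : Fin n → ℕ∞ → ℝ≥0∞ := fun i k => ENNReal.ofReal (s i) ^ k.toNat
  have hg : ∀ i, Measurable (g i) := fun i => measurable_of_countable _
  rw [lintegral_congr_ae hae]
  refine (lintegral_prod_of_iIndepFun ((hΦ.iIndepFun_count n B hB hfin hdisj).comp g hg)
    fun i => (hg i).comp_aemeasurable
      (hΦ.hasLaw_count (B i) (hB i) (hfin i)).aemeasurable).trans ?_
  refine Finset.prod_congr rfl fun i _ => ?_
  simp only [Function.comp_apply]
  rw [hΦ.lintegral_encard (hB i) (hfin i) (g i)]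
  simp only [g, ENat.toNat_natCast]
  rw [lintegral_pow_poissonMeasure _ (hs0 i)]
  rfl

lemma lintegral_infProd_simpleFunc (hΦ : IsHomogeneousPPP Φ lam P)
    (hxΦ : ∀ᵐ ω ∂P, Set.BijOn (fun l => x l ω) Set.univ (Φ ω))
    (u : SimpleFunc Plane ℝ≥0∞) (hu1 : ∀ z, u z ≤ 1) (hu : ∫⁻ z, u z ≠ ∞) :
    ∫⁻ ω, infProd (fun z => 1 - u z) (fun l => x l ω) ∂P =
      ENNReal.ofReal (Real.exp (-(ENNReal.ofReal lam * ∫⁻ z, u z).toReal)) := by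
  classical
  -- The value `0` is dropped: its level set may have infinite area, but it only contributes factors
  -- `1`. The other level sets have finite area by Markov's inequality.
  let R : Finset ℝ≥0∞ := u.range.filter (· ≠ 0)
  let e : Fin R.card ≃ R := R.equivFin.symm
  have hle1 : ∀ c ∈ R, c ≤ 1 := fun c hc => by
    obtain ⟨z, rfl⟩ := SimpleFunc.mem_range.1 (Finset.mem_filter.1 hc).1
    exact hu1 z
  have hvol : ∀ c ∈ R, volume (u ⁻¹' {c}) ≠ ∞ := fun c hc => by
    have h := mul_meas_ge_le_lintegral (μ := volume) u.measurable c
    have hsub : u ⁻¹' {c} ⊆ {z | c ≤ u z} := fun z hz => (Set.mem_singleton_iff.1 hz).ge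
    refine ne_top_of_le_ne_top ?_ (measure_mono hsub)
    intro htop
    rw [htop, ENNReal.mul_top (Finset.mem_filter.1 hc).2] at h
    exact hu (top_le_iff.1 h)
  have hprod : ∀ z, 1 - u z = ∏ i, (u ⁻¹' {(e i : ℝ≥0∞)}).mulIndicator
      (fun _ => ENNReal.ofReal (1 - (e i : ℝ≥0∞).toReal)) z := fun z => by
    rw [e.prod_comp (fun c : R => (u ⁻¹' {(c : ℝ≥0∞)}).mulIndicator
      (fun _ => ENNReal.ofReal (1 - (c : ℝ≥0∞).toReal)) z),
      Finset.prod_coe_sort R (fun c => (u ⁻¹' {c}).mulIndicator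
      (fun _ => ENNReal.ofReal (1 - c.toReal)) z)]
    simp only [Set.mulIndicator_apply, Set.mem_preimage, Set.mem_singleton_iff]
    rw [Finset.prod_ite_eq]
    split_ifs with hz
    · rw [ENNReal.ofReal_sub _ ENNReal.toReal_nonneg, ENNReal.ofReal_one,
        ENNReal.ofReal_toReal (ne_top_of_le_ne_top ENNReal.one_ne_top (hu1 z))]
    · have : u z = 0 := by
        by_contra h0
        exact hz (Finset.mem_filter.2 ⟨SimpleFunc.mem_range_self u z, h0⟩)
      rw [this, tsub_zero]
  simp_rw [hprod]
  rw [lintegral_infProd_step hΦ hxΦ (fun i => u.measurableSet_preimage _)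
    (fun i => hvol _ (e i).2) ?_ ?_ ?_]
  · rw [e.prod_comp (fun c : R => ENNReal.ofReal (Real.exp (-((ENNReal.ofReal lam *
      volume (u ⁻¹' {(c : ℝ≥0∞)})).toReal * (1 - (1 - (c : ℝ≥0∞).toReal)))))),
      Finset.prod_coe_sort R (fun c => ENNReal.ofReal (Real.exp (-((ENNReal.ofReal lam *
      volume (u ⁻¹' {c})).toReal * (1 - (1 - c.toReal)))))),
      ← ENNReal.ofReal_prod_of_nonneg fun c _ => (Real.exp_pos _).le, ← Real.exp_sum]
    congr 2
    have hsum : ∫⁻ z, u z = ∑ c ∈ R, c * volume (u ⁻¹' {c}) := by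
      rw [SimpleFunc.lintegral_eq_lintegral, SimpleFunc.lintegral,
        Finset.sum_filter_of_ne fun c _ hc => left_ne_zero_of_mul hc]
    rw [Finset.sum_neg_distrib, neg_inj, hsum, Finset.mul_sum, ENNReal.toReal_sum]
    · refine Finset.sum_congr rfl fun c _ => ?_
      simp only [ENNReal.toReal_mul]
      ring
    · exact fun c hc => ENNReal.mul_ne_top ENNReal.ofReal_ne_top (ENNReal.mul_ne_top
        (ne_top_of_le_ne_top ENNReal.one_ne_top (hle1 c hc)) (hvol c hc))
  · intro i j hij
    refine Set.disjoint_left.2 fun z hi hj => hij (e.injective (Subtype.ext ?_))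
    exact (Set.mem_singleton_iff.1 hi).symm.trans hj
  · exact fun i => sub_nonneg.2 (ENNReal.toReal_le_of_le_ofReal zero_le_one
      (by simpa using hle1 _ (e i).2))
  · exact fun i => sub_le_self _ ENNReal.toReal_nonneg

/-- The probability generating functional of a homogeneous Poisson point process. -/
theorem lintegral_infProd_one_sub [IsProbabilityMeasure P] (hΦ : IsHomogeneousPPP Φ lam P)
    (hx : ∀ l, Measurable (x l))
    (hxΦ : ∀ᵐ ω ∂P, Set.BijOn (fun l => x l ω) Set.univ (Φ ω))
    {u : Plane → ℝ≥0∞} (hum : Measurable u) (hu1 : ∀ z, u z ≤ 1) (hu : ∫⁻ z, u z ≠ ∞) :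
    ∫⁻ ω, infProd (fun z => 1 - u z) (fun l => x l ω) ∂P =
      ENNReal.ofReal (Real.exp (-(ENNReal.ofReal lam * ∫⁻ z, u z).toReal)) := by
  -- Simple functions increasing to `u` make `1 - u` a decreasing limit, so the products and their
  -- means converge monotonically.
  have hsup : ∀ z, ⨆ n, SimpleFunc.eapprox u n z = u z := SimpleFunc.iSup_eapprox_apply hum
  have hle : ∀ n z, SimpleFunc.eapprox u n z ≤ u z := fun n z => by
    rw [← hsup z]
    exact le_iSup (fun n => SimpleFunc.eapprox u n z) n
  have hanti : Antitone fun n z => 1 - SimpleFunc.eapprox u n z := fun m n hmn z =>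
    tsub_le_tsub_left (SimpleFunc.monotone_eapprox u hmn z) 1
  have hsub : (fun z => 1 - u z) = fun z => ⨅ n, (1 - SimpleFunc.eapprox u n z) := by
    funext z
    rw [← hsup z, ENNReal.sub_iSup ENNReal.one_ne_top]
  have hmeas : ∀ n, Measurable fun ω =>
      infProd (fun z => 1 - SimpleFunc.eapprox u n z) (fun l => x l ω) := fun n =>
    measurable_infProd (measurable_const.sub (SimpleFunc.eapprox u n).measurable) hx
  have hinfanti : Antitone fun n ω =>
      infProd (fun z => 1 - SimpleFunc.eapprox u n z) (fun l => x l ω) := fun m n hmn ω =>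
    iInf_mono fun K => Finset.prod_le_prod' fun l _ => hanti hmn _
  rw [hsub]
  simp_rw [infProd_iInf hanti (fun n z => tsub_le_self)]
  rw [lintegral_iInf hmeas hinfanti]
  · have hint : ∀ n, ∫⁻ z, SimpleFunc.eapprox u n z ≠ ∞ := fun n =>
      ne_top_of_le_ne_top hu (lintegral_mono (hle n))
    simp_rw [fun n => lintegral_infProd_simpleFunc hΦ hxΦ (SimpleFunc.eapprox u n)
      (fun z => (hle n z).trans (hu1 z)) (hint n)]
    have hmono : Monotone fun n => ∫⁻ z, SimpleFunc.eapprox u n z := fun m n hmn =>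
      lintegral_mono (SimpleFunc.monotone_eapprox u hmn)
    have hlim : Filter.Tendsto (fun n => ∫⁻ z, SimpleFunc.eapprox u n z) Filter.atTop
        (nhds (∫⁻ z, u z)) := by
      have h := tendsto_atTop_iSup hmono
      rw [← lintegral_iSup (fun n => (SimpleFunc.eapprox u n).measurable)
        (SimpleFunc.monotone_eapprox u)] at h
      simpa only [hsup] using h
    have hlim2 := ENNReal.Tendsto.const_mul hlim (a := ENNReal.ofReal lam)
      (Or.inr ENNReal.ofReal_ne_top)
    have hlim3 := (ENNReal.tendsto_toReal
      (ENNReal.mul_ne_top ENNReal.ofReal_ne_top hu)).comp hlim2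
    have hlim4 := ENNReal.tendsto_ofReal ((Real.continuous_exp.tendsto _).comp hlim3.neg)
    refine tendsto_nhds_unique (tendsto_atTop_iInf fun m n hmn => ?_) hlim4
    refine ENNReal.ofReal_le_ofReal (Real.exp_le_exp.2 (neg_le_neg ?_))
    exact ENNReal.toReal_mono (ENNReal.mul_ne_top ENNReal.ofReal_ne_top (hint n))
      (mul_le_mul_right (hmono hmn) _)
  · refine ne_top_of_le_ne_top ENNReal.one_ne_top ?_
    calc _ ≤ ∫⁻ _, 1 ∂P := lintegral_mono fun ω => iInf_le_of_le 0 (by simp)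
      _ = 1 := by simp

end PoissonProcess

/-! ### Fading for fixed positions -/

/-- The probability that the channel gain to a receiver at `z` exceeds `m`. -/
noncomputable def exceedProb (α m : ℝ) (z : Plane) : ℝ≥0∞ :=
  ENNReal.ofReal (Real.exp (-(m * (1 + ‖z‖ ^ α))))

lemma measurable_exceedProb (α m : ℝ) : Measurable (exceedProb α m) := by
  unfold exceedProb
  fun_prop

lemma exceedProb_le_one (α : ℝ) {m : ℝ} (hm : 0 ≤ m) (z : Plane) : exceedProb α m z ≤ 1 := by
  refine ENNReal.ofReal_le_one.2 (Real.exp_le_one_iff.2 (neg_nonpos.2 ?_))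
  have := Real.rpow_nonneg (norm_nonneg z) α
  positivity

lemma lt_channelGain_iff {α m : ℝ} {z : Plane} {w : ℂ} :
    m < channelGain α z w ↔ m * (1 + ‖z‖ ^ α) < ‖w‖ ^ 2 := by
  have := Real.rpow_nonneg (norm_nonneg z) α
  rw [channelGain, pathLoss, mul_one_div, lt_div_iff₀ (by positivity)]

lemma measurable_channelGain (α : ℝ) :
    Measurable fun p : Plane × ℂ => channelGain α p.1 p.2 := by
  unfold channelGain pathLoss
  fun_prop

lemma maxGain_le_iff {α m : ℝ} (hm : 0 ≤ m) {y : ℕ → Plane} {w : ℕ → ℂ} :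
    maxGain α y w ≤ ENNReal.ofReal m ↔ ∀ l, channelGain α (y l) (w l) ≤ m := by
  simp only [maxGain, iSup_le_iff, ENNReal.ofReal_le_ofReal_iff hm]

/-- Fubini for the product law: `X` is frozen while `Y` is averaged, which amounts to conditioning
on the positions. -/
lemma measure_mem_of_indepFun {Ω E F : Type*} [MeasurableSpace Ω] [MeasurableSpace E]
    [MeasurableSpace F] {P : Measure Ω} [IsProbabilityMeasure P] {X : Ω → E} {Y : Ω → F}
    (hX : Measurable X) (hY : Measurable Y) (hXY : IndepFun X Y P) {A : Set (E × F)}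
    (hA : MeasurableSet A) :
    P {ω | (X ω, Y ω) ∈ A} = ∫⁻ ω, P {ω' | (X ω, Y ω') ∈ A} ∂P := by
  have h1 : P {ω | (X ω, Y ω) ∈ A} = P.map (fun ω => (X ω, Y ω)) A :=
    (Measure.map_apply (hX.prodMk hY) hA).symm
  have := Measure.isProbabilityMeasure_map (μ := P) hY.aemeasurable
  rw [h1, (indepFun_iff_map_prod_eq_prod_map_map hX.aemeasurable hY.aemeasurable).1 hXY,
    Measure.prod_apply hA, lintegral_map (measurable_measure_prodMk_left hA) hX]
  exact lintegral_congr fun ω => Measure.map_apply hY (measurable_prodMk_left hA)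

section Fading

variable {Ω : Type*} [MeasurableSpace Ω] {P : Measure Ω} {α : ℝ}
  {h : ℕ → Ω → ℂ}

lemma measurableSet_lt_channelGain {w : Ω → ℂ} (hw : Measurable w) (m : ℝ) (z : Plane) :
    MeasurableSet {ω | m < channelGain α z (w ω)} :=
  measurableSet_lt measurable_const ((measurable_channelGain α).comp (measurable_const.prodMk hw))

lemma measure_lt_channelGain {w : Ω → ℂ} (hlaw : HasLaw w complexGaussian P)
    {m : ℝ} (hm : 0 ≤ m) (z : Plane) :
    P {ω | m < channelGain α z (w ω)} = exceedProb α m z := by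
  have := Real.rpow_nonneg (norm_nonneg z) α
  simp_rw [lt_channelGain_iff]
  rw [hlaw.measure_eq (p := fun v => m * (1 + ‖z‖ ^ α) < ‖v‖ ^ 2)
    (measurableSet_lt measurable_const (by fun_prop)),
    complexGaussian_lt_norm_sq (by positivity)]
  rfl

/-- Independence handles the first `K` receivers; letting `K` grow is continuity from above,
matching the infimum in `infProd`. -/
lemma measure_forall_channelGain_le [IsProbabilityMeasure P] (hh : ∀ l, Measurable (h l))
    (hlaw : ∀ l, HasLaw (h l) complexGaussian P) (hindep : iIndepFun h P)
    {m : ℝ} (hm : 0 ≤ m) (y : ℕ → Plane) :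
    P {ω | ∀ l, channelGain α (y l) (h l ω) ≤ m} =
      infProd (fun z => 1 - exceedProb α m z) y := by
  let S : ℕ → Set ℂ := fun l => {v | channelGain α (y l) v ≤ m}
  have hS : ∀ l, MeasurableSet (S l) := fun l =>
    measurableSet_le ((measurable_channelGain α).comp (measurable_const.prodMk measurable_id))
      measurable_const
  let T : ℕ → Set Ω := fun K => ⋂ l ∈ Finset.range K, h l ⁻¹' S l
  have hT : ∀ K, MeasurableSet (T K) := fun K =>
    Finset.measurableSet_biInter _ fun l _ => hh l (hS l)
  have hanti : Antitone T := fun K L hKL =>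
    Set.biInter_subset_biInter_left fun l hl =>
      Finset.mem_range.2 ((Finset.mem_range.1 hl).trans_le hKL)
  have hU : {ω | ∀ l, channelGain α (y l) (h l ω) ≤ m} = ⋂ K, T K := by
    ext ω
    simp only [T, S, Set.mem_ofPred_eq, Set.mem_iInter, Set.mem_preimage, Finset.mem_range]
    exact ⟨fun hl _ l _ => hl l, fun hl l => hl (l + 1) l (Nat.lt_succ_self l)⟩
  rw [hU, hanti.measure_iInter (fun K => (hT K).nullMeasurableSet) ⟨0, measure_ne_top P _⟩]
  refine iInf_congr fun K => ?_
  rw [hindep.measure_inter_preimage_eq_mul (Finset.range K) fun l _ => hS l]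
  refine Finset.prod_congr rfl fun l _ => ?_
  have hc : h l ⁻¹' S l = {ω | m < channelGain α (y l) (h l ω)}ᶜ := by
    ext ω
    simp [S]
  rw [hc, prob_compl_eq_one_sub (measurableSet_lt_channelGain (hh l) m (y l)),
    measure_lt_channelGain (hlaw l) hm]

end Fading

/-! ### Averaging over the receiver positions -/

section Network

variable {Ω : Type*} [MeasurableSpace Ω] {P : Measure Ω} [IsProbabilityMeasure P] {α lam : ℝ}
  {Φ : Ω → Set Plane} {x : ℕ → Ω → Plane} {h : ℕ → Ω → ℂ}

lemma measure_lt_channelGain_random (hx : ∀ l, Measurable (x l)) (hh : ∀ l, Measurable (h l))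
    (hlaw : ∀ l, HasLaw (h l) complexGaussian P)
    (hmark : IndepFun (fun ω l => x l ω) (fun ω l => h l ω) P) {m : ℝ} (hm : 0 ≤ m) (l : ℕ) :
    P {ω | m < channelGain α (x l ω) (h l ω)} = ∫⁻ ω, exceedProb α m (x l ω) ∂P := by
  have hA : MeasurableSet {p : (ℕ → Plane) × (ℕ → ℂ) | m < channelGain α (p.1 l) (p.2 l)} :=
    measurableSet_lt measurable_const ((measurable_channelGain α).comp
      (f := fun p : (ℕ → Plane) × (ℕ → ℂ) => (p.1 l, p.2 l)) (by fun_prop))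
  refine (measure_mem_of_indepFun (measurable_pi_lambda _ hx) (measurable_pi_lambda _ hh)
    hmark hA).trans ?_
  exact lintegral_congr fun ω => measure_lt_channelGain (hlaw l) hm (x l ω)

/-- The distribution function of the maximal channel gain. -/
theorem measure_maxGain_le (hα : 0 < α) (hlam : 0 < lam) (hΦ : IsHomogeneousPPP Φ lam P)
    (hx : ∀ l, Measurable (x l))
    (hxΦ : ∀ᵐ ω ∂P, Set.BijOn (fun l => x l ω) Set.univ (Φ ω))
    (hh : ∀ l, Measurable (h l)) (hlaw : ∀ l, HasLaw (h l) complexGaussian P)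
    (hindep : iIndepFun h P)
    (hmark : IndepFun (fun ω l => x l ω) (fun ω l => h l ω) P) {m : ℝ} (hm : 0 < m) :
    P {ω | maxGain α (fun l => x l ω) (fun l => h l ω) ≤ ENNReal.ofReal m} =
      ENNReal.ofReal (Real.exp (-(Real.exp (-m) *
        ((2 / α) * Real.pi * lam * Real.Gamma (2 / α)) / m ^ (2 / α)))) := by
  have hA : MeasurableSet
      {p : (ℕ → Plane) × (ℕ → ℂ) | ∀ l, channelGain α (p.1 l) (p.2 l) ≤ m} := by
    rw [Set.ofPred_forall]
    exact MeasurableSet.iInter fun l => measurableSet_le ((measurable_channelGain α).comp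
      (f := fun p : (ℕ → Plane) × (ℕ → ℂ) => (p.1 l, p.2 l)) (by fun_prop)) measurable_const
  have hu : ∫⁻ z, exceedProb α m z = ENNReal.ofReal
      (Real.exp (-m) * ((2 / α) * Real.pi * Real.Gamma (2 / α)) / m ^ (2 / α)) :=
    lintegral_exp_neg_mul_one_add_norm_rpow hα hm
  simp_rw [maxGain_le_iff hm.le]
  refine (measure_mem_of_indepFun (measurable_pi_lambda _ hx) (measurable_pi_lambda _ hh)
    hmark hA).trans ?_
  refine (lintegral_congr fun ω => measure_forall_channelGain_le hh hlaw hindep hm.le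
    fun l => x l ω).trans ?_
  rw [lintegral_infProd_one_sub hΦ hx hxΦ (measurable_exceedProb α m)
    (exceedProb_le_one α hm.le) (by rw [hu]; exact ENNReal.ofReal_ne_top), hu,
    ← ENNReal.ofReal_mul hlam.le, ENNReal.toReal_ofReal]
  · congr 3
    ring
  · have := Real.Gamma_pos_of_pos (show 0 < 2 / α by positivity)
    positivity

/-- Borel–Cantelli: Campbell's formula turns the sum of exceedance probabilities into `lam` times a
finite area integral. -/
lemma ae_finite_lt_channelGain (hα : 0 < α) (hΦ : IsHomogeneousPPP Φ lam P)
    (hx : ∀ l, Measurable (x l))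
    (hxΦ : ∀ᵐ ω ∂P, Set.BijOn (fun l => x l ω) Set.univ (Φ ω))
    (hh : ∀ l, Measurable (h l)) (hlaw : ∀ l, HasLaw (h l) complexGaussian P)
    (hmark : IndepFun (fun ω l => x l ω) (fun ω l => h l ω) P) {m : ℝ} (hm : 0 < m) :
    ∀ᵐ ω ∂P, {l | m < channelGain α (x l ω) (h l ω)}.Finite := by
  refine ae_finite_setOfPred_mem (s := fun l => {ω | m < channelGain α (x l ω) (h l ω)}) ?_
  simp_rw [measure_lt_channelGain_random hx hh hlaw hmark hm.le]
  rw [tsum_lintegral_comp hΦ hx hxΦ (measurable_exceedProb α m)]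
  unfold exceedProb
  rw [lintegral_exp_neg_mul_one_add_norm_rpow hα hm]
  exact ENNReal.mul_ne_top ENNReal.ofReal_ne_top ENNReal.ofReal_ne_top

/-- Almost surely, the maximal channel gain is attained and positive. -/
theorem ae_exists_max_channelGain (hα : 0 < α) (hΦ : IsHomogeneousPPP Φ lam P)
    (hx : ∀ l, Measurable (x l))
    (hxΦ : ∀ᵐ ω ∂P, Set.BijOn (fun l => x l ω) Set.univ (Φ ω))
    (hh : ∀ l, Measurable (h l)) (hlaw : ∀ l, HasLaw (h l) complexGaussian P)
    (hmark : IndepFun (fun ω l => x l ω) (fun ω l => h l ω) P) :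
    ∀ᵐ ω ∂P, ∃ k, 0 < channelGain α (x k ω) (h k ω) ∧
      ∀ l, channelGain α (x l ω) (h l ω) ≤ channelGain α (x k ω) (h k ω) := by
  have hpos : ∀ᵐ ω ∂P, 0 < channelGain α (x 0 ω) (h 0 ω) := by
    have hmeas : MeasurableSet {ω | 0 < channelGain α (x 0 ω) (h 0 ω)} :=
      measurableSet_lt measurable_const ((measurable_channelGain α).comp ((hx 0).prodMk (hh 0)))
    refine (mem_ae_iff_prob_eq_one hmeas).2 ?_
    rw [measure_lt_channelGain_random hx hh hlaw hmark le_rfl]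
    -- At level `0` the exceedance probability is `1` at every position.
    simp [exceedProb]
  have hfin : ∀ᵐ ω ∂P, ∀ n : ℕ,
      {l | 1 / ((n : ℝ) + 1) < channelGain α (x l ω) (h l ω)}.Finite :=
    ae_all_iff.2 fun n => ae_finite_lt_channelGain hα hΦ hx hxΦ hh hlaw hmark
      Nat.one_div_pos_of_nat
  filter_upwards [hpos, hfin] with ω h0 hf
  -- A level below the gain of receiver `0` is exceeded by a nonempty finite set of receivers; the
  -- largest gain in that set also dominates all the others.
  obtain ⟨n, hn⟩ := exists_nat_one_div_lt h0
  obtain ⟨k, hk, hmax⟩ := Set.exists_max_image _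
    (fun l => channelGain α (x l ω) (h l ω)) (hf n) ⟨0, hn⟩
  refine ⟨k, h0.trans_le (hmax 0 hn), fun l => ?_⟩
  by_cases hl : 1 / ((n : ℝ) + 1) < channelGain α (x l ω) (h l ω)
  · exact hmax l hl
  · exact (not_lt.1 hl).trans (le_of_lt hk)

end Network

/-! ### Law of the effective SNR -/

/-- The survival function `exp (-a y ^ δ exp (-ρp / y))` of the effective transmit SNR. -/
noncomputable def snrTail (α lam ρp y : ℝ) : ℝ :=
  Real.exp (-(aCoeff α lam ρp * y ^ (2 / α) * Real.exp (-(ρp / y))))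

variable {α lam ρp ρs : ℝ}

lemma aCoeff_pos (hα : 0 < α) (hlam : 0 < lam) (hρp : 0 < ρp) : 0 < aCoeff α lam ρp := by
  have := Real.Gamma_pos_of_pos (show 0 < 2 / α by positivity)
  unfold aCoeff
  positivity

lemma snrTail_zero (hα : 0 < α) : snrTail α lam ρp 0 = 1 := by
  have : (2 / α) ≠ 0 := by positivity
  simp [snrTail, Real.zero_rpow this]

lemma hasDerivAt_neg_snrTail {y : ℝ} (hy : 0 < y) :
    HasDerivAt (fun y => -snrTail α lam ρp y) (snrDensity α lam ρp y) y := by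
  have h1 : HasDerivAt (fun y : ℝ => y ^ (2 / α)) (2 / α * y ^ (2 / α - 1)) y :=
    Real.hasDerivAt_rpow_const (Or.inl hy.ne')
  have h2 : HasDerivAt (fun y : ℝ => Real.exp (-(ρp / y)))
      (Real.exp (-(ρp / y)) * (ρp / y ^ 2)) y := by
    refine (((hasDerivAt_inv hy.ne').const_mul ρp).neg.exp).congr_deriv ?_
    simp only [Pi.neg_apply, div_eq_mul_inv]
    ring
  refine ((((h1.const_mul (aCoeff α lam ρp)).mul h2).neg.exp).neg).congr_deriv ?_
  have hpow : y ^ (2 / α) = y ^ (2 / α - 1) * y := by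
    rw [← Real.rpow_add_one hy.ne', sub_add_cancel]
  rw [snrDensity, sub_eq_add_neg _ (ρp / y), Real.exp_add]
  simp only [Pi.neg_apply, Pi.mul_apply]
  rw [hpow]
  field_simp
  ring

/-- Only the endpoint `0` is delicate. There `ρp / 0 = 0` makes the inner exponential `1`, but it is
bounded by `1` on `[0, ∞)` and `y ^ δ` tends to `0`. -/
lemma continuousOn_snrTail (hα : 0 < α) (hlam : 0 < lam) (hρp : 0 < ρp) :
    ContinuousOn (snrTail α lam ρp) (Set.Ici 0) := by
  intro y hy
  rcases (Set.mem_Ici.1 hy).eq_or_lt with rfl | hy0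
  · have hδ : 0 < 2 / α := by positivity
    have ha := aCoeff_pos hα hlam hρp
    have h1 : Filter.Tendsto (fun y : ℝ => aCoeff α lam ρp * y ^ (2 / α))
        (nhdsWithin 0 (Set.Ici 0)) (nhds 0) := by
      have h := ((Real.continuousAt_rpow_const 0 (2 / α) (Or.inr hδ.le)).tendsto.const_mul
        (aCoeff α lam ρp)).mono_left (nhdsWithin_le_nhds (s := Set.Ici 0))
      rwa [Real.zero_rpow hδ.ne', mul_zero] at h
    have h2 : Filter.Tendsto (fun y : ℝ => aCoeff α lam ρp * y ^ (2 / α) * Real.exp (-(ρp / y)))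
        (nhdsWithin 0 (Set.Ici 0)) (nhds 0) := by
      refine squeeze_zero' ?_ ?_ h1
      · filter_upwards [self_mem_nhdsWithin] with z hz
        have hz : 0 ≤ z := hz
        positivity
      · filter_upwards [self_mem_nhdsWithin] with z hz
        have hz : 0 ≤ z := hz
        refine mul_le_of_le_one_right (by positivity) (Real.exp_le_one_iff.2 ?_)
        exact neg_nonpos.2 (by positivity)
    rw [ContinuousWithinAt, snrTail_zero hα]
    have h3 := (Real.continuous_exp.tendsto _).comp h2.neg
    rwa [neg_zero, Real.exp_zero] at h3
  · have h1 := (hasDerivAt_neg_snrTail (α := α) (lam := lam) (ρp := ρp) hy0).continuousAt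
    exact (continuousAt_neg_iff.1 h1).continuousWithinAt

lemma lintegral_snrDensity (hα : 0 < α) (hlam : 0 < lam) (hρp : 0 < ρp) {y : ℝ} (hy : 0 ≤ y)
    (hys : y ≤ ρs) :
    ∫⁻ z in Set.Ioc y ρs, ENNReal.ofReal (snrDensity α lam ρp z) =
      ENNReal.ofReal (snrTail α lam ρp y - snrTail α lam ρp ρs) := by
  have ha := aCoeff_pos hα hlam hρp
  have hcont : ContinuousOn (fun z => -snrTail α lam ρp z) (Set.Icc y ρs) :=
    ((continuousOn_snrTail hα hlam hρp).mono fun z hz => hy.trans hz.1).neg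
  have hderiv : ∀ z ∈ Set.Ioo y ρs,
      HasDerivAt (fun z => -snrTail α lam ρp z) (snrDensity α lam ρp z) z := fun z hz =>
    hasDerivAt_neg_snrTail (hy.trans_lt hz.1)
  have hnn : ∀ z, 0 ≤ z → 0 ≤ snrDensity α lam ρp z := fun z hz => by
    unfold snrDensity
    positivity
  -- Integrability is automatic for a nonnegative derivative of a function continuous up to the
  -- endpoints, so `y = 0` is covered.
  have hint : IntegrableOn (snrDensity α lam ρp) (Set.Ioc y ρs) :=
    intervalIntegral.integrableOn_deriv_of_nonneg hcont hderiv
      fun z hz => hnn z (hy.trans hz.1.le)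
  rw [← ofReal_integral_eq_lintegral_ofReal hint
    ((ae_restrict_iff' measurableSet_Ioc).2
      (Filter.Eventually.of_forall fun z hz => hnn z (hy.trans hz.1.le))),
    ← intervalIntegral.integral_of_le hys,
    intervalIntegral.integral_eq_sub_of_hasDerivAt_of_le hys hcont hderiv
      ((intervalIntegrable_iff_integrableOn_Ioc_of_le hys).2 hint)]
  congr 1
  ring

/-- The law of the effective transmit SNR. -/
noncomputable def snrLaw (α lam ρp ρs : ℝ) : Measure ℝ :=
  ENNReal.ofReal (atomWeight α lam ρp ρs) • Measure.dirac ρs +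
    (volume.restrict (Set.Ioo 0 ρs)).withDensity
      (fun y => ENNReal.ofReal (snrDensity α lam ρp y))

lemma snrLaw_Ici_of_lt {y : ℝ} (hy : ρs < y) : snrLaw α lam ρp ρs (Set.Ici y) = 0 := by
  have hempty : Set.Ici y ∩ Set.Ioo 0 ρs = ∅ := by
    ext z
    simp only [Set.mem_inter_iff, Set.mem_Ici, Set.mem_Ioo, Set.mem_empty_iff_false, iff_false]
    intro h
    linarith [h.1, h.2.2]
  rw [snrLaw, Measure.add_apply, Measure.smul_apply,
    Measure.dirac_apply' _ measurableSet_Ici, withDensity_apply _ measurableSet_Ici,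
    Measure.restrict_restrict measurableSet_Ici, hempty]
  simp [hy]

/-- The density contributes the drop of the tail from `max y 0` to `ρs`, and the atom restores the
tail at `ρs`. -/
lemma snrLaw_Ici (hα : 0 < α) (hlam : 0 < lam) (hρp : 0 < ρp) (hρs : 0 < ρs) {y : ℝ}
    (hy : y ≤ ρs) :
    snrLaw α lam ρp ρs (Set.Ici y) = ENNReal.ofReal (snrTail α lam ρp (max y 0)) := by
  have hset : (Set.Ici y ∩ Set.Ioo 0 ρs : Set ℝ) =ᵐ[volume] Set.Ioc (max y 0) ρs := by
    have h1 : (Set.Ici y ∩ Set.Ioo 0 ρs : Set ℝ) =ᵐ[volume] (Set.Ioi y ∩ Set.Ioc 0 ρs : Set ℝ) :=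
      Ioi_ae_eq_Ici.symm.inter Ioo_ae_eq_Ioc
    have h2 : (Set.Ioi y ∩ Set.Ioc 0 ρs : Set ℝ) = Set.Ioc (max y 0) ρs := by
      ext z
      simp only [Set.mem_inter_iff, Set.mem_Ioi, Set.mem_Ioc, max_lt_iff, and_assoc]
    rwa [h2] at h1
  have hmax : max y 0 ≤ ρs := max_le hy hρs.le
  have hint := lintegral_snrDensity (ρs := ρs) hα hlam hρp (le_max_right y 0) hmax
  rw [snrLaw, Measure.add_apply, Measure.smul_apply,
    Measure.dirac_apply' _ measurableSet_Ici, withDensity_apply _ measurableSet_Ici,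
    Measure.restrict_restrict measurableSet_Ici, setLIntegral_congr hset, hint]
  have hle : snrTail α lam ρp ρs ≤ snrTail α lam ρp (max y 0) := by
    have hcont : ContinuousOn (fun z => -snrTail α lam ρp z) (Set.Icc (max y 0) ρs) :=
      ((continuousOn_snrTail hα hlam hρp).mono fun z hz => (le_max_right y 0).trans hz.1).neg
    have hmono : MonotoneOn (fun z => -snrTail α lam ρp z) (Set.Icc (max y 0) ρs) := by
      refine monotoneOn_of_hasDerivWithinAt_nonneg (f' := snrDensity α lam ρp)
        (convex_Icc _ _) hcont (fun z hz => ?_) fun z hz => ?_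
      · rw [interior_Icc] at hz
        exact (hasDerivAt_neg_snrTail ((le_max_right y 0).trans_lt hz.1)).hasDerivWithinAt
      · rw [interior_Icc] at hz
        have ha := aCoeff_pos hα hlam hρp
        have hz0 : 0 < z := (le_max_right y 0).trans_lt hz.1
        unfold snrDensity
        positivity
    exact neg_le_neg_iff.1 (hmono (Set.left_mem_Icc.2 hmax) (Set.right_mem_Icc.2 hmax) hmax)
  have hatom : atomWeight α lam ρp ρs = snrTail α lam ρp ρs := rfl
  rw [Set.indicator_of_mem (Set.mem_Ici.2 hy), Pi.one_apply, smul_eq_mul, mul_one, hatom,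
    ← ENNReal.ofReal_add (p := snrTail α lam ρp ρs) (Real.exp_pos _).le (sub_nonneg.2 hle), add_sub_cancel]

lemma snrTail_eq (hα : 0 < α) (hρp : 0 < ρp) {y : ℝ} (hy : 0 < y) :
    snrTail α lam ρp y = Real.exp (-(Real.exp (-(ρp / y)) *
      ((2 / α) * Real.pi * lam * Real.Gamma (2 / α)) / (ρp / y) ^ (2 / α))) := by
  rw [snrTail, aCoeff, Real.div_rpow hρp.le hy.le]
  congr 2
  have h1 : 0 < y ^ (2 / α) := Real.rpow_pos_of_pos hy _
  have h2 : 0 < ρp ^ (2 / α) := Real.rpow_pos_of_pos hρp _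
  field_simp

lemma effectiveSNR_le (hρs : 0 < ρs) (y : ℕ → Plane) (w : ℕ → ℂ) :
    effectiveSNR α ρp ρs y w ≤ ρs :=
  (ENNReal.toReal_mono ENNReal.ofReal_ne_top (min_le_right _ _)).trans_eq
    (ENNReal.toReal_ofReal hρs.le)

/-- For `t ≤ ρs` the cap plays no role, and it keeps the minimum finite so that `toReal` preserves
the order. Extended division also covers a zero or infinite maximum. -/
lemma le_effectiveSNR_iff (hρp : 0 < ρp) {t : ℝ} (ht : 0 < t) (hts : t ≤ ρs)
    (y : ℕ → Plane) (w : ℕ → ℂ) :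
    t ≤ effectiveSNR α ρp ρs y w ↔ maxGain α y w ≤ ENNReal.ofReal (ρp / t) := by
  have hp : ENNReal.ofReal ρp ≠ 0 := (ENNReal.ofReal_pos.2 hρp).ne'
  have ht0 : ENNReal.ofReal t ≠ 0 := (ENNReal.ofReal_pos.2 ht).ne'
  rw [effectiveSNR, ← ENNReal.ofReal_le_iff_le_toReal
    (ne_top_of_le_ne_top ENNReal.ofReal_ne_top (min_le_right _ _)), le_min_iff,
    and_iff_left (ENNReal.ofReal_le_ofReal hts), ENNReal.ofReal_div_of_pos ht,
    ENNReal.le_div_iff_mul_le (Or.inr hp) (Or.inr ENNReal.ofReal_ne_top),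
    ENNReal.le_div_iff_mul_le (Or.inl ht0) (Or.inl ENNReal.ofReal_ne_top), mul_comm]

section Network

variable {Ω : Type*} [MeasurableSpace Ω] {P : Measure Ω}
  {Φ : Ω → Set Plane} {x : ℕ → Ω → Plane} {h : ℕ → Ω → ℂ}

lemma measurable_effectiveSNR (hx : ∀ l, Measurable (x l)) (hh : ∀ l, Measurable (h l)) :
    Measurable fun ω => effectiveSNR α ρp ρs (fun l => x l ω) (fun l => h l ω) := by
  have hmax : Measurable fun ω => maxGain α (fun l => x l ω) (fun l => h l ω) :=
    Measurable.iSup fun l =>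
      ((measurable_channelGain α).comp ((hx l).prodMk (hh l))).ennreal_ofReal
  exact ((measurable_const.div hmax).min measurable_const).ennreal_toReal

/-- The law of the effective transmit SNR. -/
theorem hasLaw_effectiveSNR [IsProbabilityMeasure P] (hα : 0 < α) (hlam : 0 < lam) (hρp : 0 < ρp)
    (hρs : 0 < ρs) (hΦ : IsHomogeneousPPP Φ lam P) (hx : ∀ l, Measurable (x l))
    (hxΦ : ∀ᵐ ω ∂P, Set.BijOn (fun l => x l ω) Set.univ (Φ ω))
    (hh : ∀ l, Measurable (h l)) (hlaw : ∀ l, HasLaw (h l) complexGaussian P)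
    (hindep : iIndepFun h P)
    (hmark : IndepFun (fun ω l => x l ω) (fun ω l => h l ω) P) :
    HasLaw (fun ω => effectiveSNR α ρp ρs (fun l => x l ω) (fun l => h l ω))
      (snrLaw α lam ρp ρs) P := by
  have hmeas := measurable_effectiveSNR (α := α) (ρp := ρp) (ρs := ρs) hx hh
  refine ⟨hmeas.aemeasurable, ?_⟩
  have := Measure.isProbabilityMeasure_map (μ := P) hmeas.aemeasurable
  -- Closed half-lines determine the law, and they match the non-strict event `maxGain ≤ ρp / y`.
  refine Measure.ext_of_Ici _ _ fun y => ?_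
  rw [Measure.map_apply hmeas measurableSet_Ici]
  rcases lt_or_ge ρs y with hy | hy
  · rw [snrLaw_Ici_of_lt hy]
    refine measure_mono_null (fun ω hω => ?_) measure_empty
    exact absurd ((Set.mem_Ici.1 hω).trans (effectiveSNR_le hρs _ _)) hy.not_ge
  rw [snrLaw_Ici hα hlam hρp hρs hy]
  rcases le_or_gt y 0 with hy0 | hy0
  · rw [max_eq_right hy0, snrTail_zero hα, ENNReal.ofReal_one, ← measure_univ (μ := P)]
    congr 1
    exact Set.eq_univ_of_forall fun ω => hy0.trans ENNReal.toReal_nonneg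
  · rw [max_eq_left hy0.le, snrTail_eq hα hρp hy0,
      ← measure_maxGain_le hα hlam hΦ hx hxΦ hh hlaw hindep hmark (div_pos hρp hy0)]
    congr 1
    ext ω
    exact le_effectiveSNR_iff hρp hy0 hy _ _

end Network

end SpectrumSharing

/-- `Φ` is the set of primary receivers, `x` a measurable enumeration of it (it is almost surely
infinite), `h` the small-scale fading coefficients. -/
theorem theorem1 {Ω : Type*} [MeasurableSpace Ω] (P : Measure Ω) [IsProbabilityMeasure P]
    (α lam ρp ρs : ℝ) (hα : 0 < α) (hlam : 0 < lam) (hρp : 0 < ρp) (hρs : 0 < ρs)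
    (Φ : Ω → Set SpectrumSharing.Plane) (hΦ : SpectrumSharing.IsHomogeneousPPP Φ lam P)
    (x : ℕ → Ω → SpectrumSharing.Plane) (hx : ∀ l, Measurable (x l))
    (hxΦ : ∀ᵐ ω ∂P, Set.BijOn (fun l => x l ω) Set.univ (Φ ω))
    (h : ℕ → Ω → ℂ) (hh : ∀ l, Measurable (h l))
    (hlaw : ∀ l, HasLaw (h l) SpectrumSharing.complexGaussian P)
    (hindep : iIndepFun h P)
    (hmark : IndepFun (fun ω l => x l ω) (fun ω l => h l ω) P) :
    -- the maximum is almost surely attained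
    (∀ᵐ ω ∂P, ∃ k, 0 < SpectrumSharing.channelGain α (x k ω) (h k ω) ∧
      ∀ l, SpectrumSharing.channelGain α (x l ω) (h l ω) ≤
        SpectrumSharing.channelGain α (x k ω) (h k ω)) ∧
    -- the distribution function of the maximum
    (∀ m : ℝ, 0 < m →
      P {ω | SpectrumSharing.maxGain α (fun l => x l ω) (fun l => h l ω) ≤ ENNReal.ofReal m} =
        ENNReal.ofReal (Real.exp (-(Real.exp (-m) *
          ((2 / α) * Real.pi * lam * Real.Gamma (2 / α)) / m ^ (2 / α))))) ∧
    -- the distribution of the effective transmit SNR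
    HasLaw
      (fun ω => SpectrumSharing.effectiveSNR α ρp ρs (fun l => x l ω) (fun l => h l ω))
      (ENNReal.ofReal (SpectrumSharing.atomWeight α lam ρp ρs) • Measure.dirac ρs +
        (volume.restrict (Set.Ioo 0 ρs)).withDensity
          (fun y => ENNReal.ofReal (SpectrumSharing.snrDensity α lam ρp y))) P := by
  exact ⟨SpectrumSharing.ae_exists_max_channelGain hα hΦ hx hxΦ hh hlaw hmark,
    fun m hm => SpectrumSharing.measure_maxGain_le hα hlam hΦ hx hxΦ hh hlaw hindep hmark hm,
    SpectrumSharing.hasLaw_effectiveSNR hα hlam hρp hρs hΦ hx hxΦ hh hlaw hindep hmark⟩
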